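/- **Setting.** Let $\mathbb K=\mathbb R$ or $\mathbb C$, and let $\alpha_1,\dots,\alpha_N\in\mathbb K$ be non-zero with $\alpha_1^2,\dots,\alpha_N^2$ distinct, $A=\operatorname{diag}(\alpha_1,\dots,\alpha_N)$. For $(p,q)\in\mathbb K^{2N}$ write $\langle\xi,\eta\rangle=\sum_j\xi_j\eta_j$, $Q_\lambda(\xi,\eta)=\sum_{j}\frac{\xi_j\eta_j}{\lambda^2-\alpha_j^2}$, $$L(\lambda;p,q)=\begin{pmatrix}\lambda Q_\lambda(p,q)&1-Q_\lambda(Ap,p)\\ Q_\lambda(Aq,q)&-\lambda Q_\lambda(p,q)\end{pmatrix},\qquad \mathcal F_\lambda=\det L(\lambda;p,q),\qquad F_1=-\langle Aq,q\rangle-\langle p,q\rangle^2 .$$ For $\gamma\in\mathbb K$ with $\gamma^2\ne\alpha_j^2$ for all $j$, and square roots $(\alpha_j^2-\gamma^2)^{1/2}\in\mathbb K$ fixed once and for all, let $\mathcal S_\gamma:(p,q)\mapsto(\tilde p,\tilde q)$ be given by $$\begin{pmatrix}\tilde p_j\\ \tilde q_j\end{pmatrix}=(\alpha_j^2-\gamma^2)^{-1/2}\begin{pmatrix}\alpha_jp_j+\gamma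 b\,q_j\\ \gamma b^{-1}p_j+\alpha_jq_j\end{pmatrix},\qquad b=f_\gamma(p,q)=\frac{-\gamma Q_\gamma(p,q)\pm\sqrt{-\mathcal F_\gamma(p,q)}}{Q_\gamma(Aq,q)},$$ where $\pm\sqrt{\cdot}$ is a fixed branch of the square root, i.e. a fixed function of the value of $-\mathcal F_\gamma$. Its domain is the set of $(p,q)$ at which $-\mathcal F_\gamma$ has a square root in $\mathbb K$, $Q_\gamma(Aq,q)\neq0$ and $b\ne0$. **Proposition 4.1.** Let $\mathcal S_{\gamma_1},\mathcal S_{\gamma_2}$ be two such maps (each with its own fixed choices of square roots). 1. $\mathcal S_{\gamma_1}\mathcal S_{\gamma_2}=\mathcal S_{\gamma_2}\mathcal S_{\gamma_1}$ at every point at which both compositions are defined. 2. For $(p_0,q_0)\in\mathbb K^{2N}$ and integers $m,n\ge0$ put $(p(m,n),q(m,n))=\mathcal S_{\gamma_1}^m\mathcal S_{\gamma_2}^n(p_0,q_0)$, $u_{mn}=\langle p(m,n),q(m,n)\rangle$ and $$v_{mn}=\frac{u_{mn}-\sqrt{-F_1}}{u_{mn}+\sqrt{-F_1}}\in\mathbb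 C,$$ where $F_1$ is evaluated at $(p(m,n),q(m,n))$ and $\sqrt{\cdot}$ is a fixed branch of the square root on $\mathbb C$. Let $m,n\ge0$ be such that all edges of the lattice rectangle $[0,m+1]\times[0,n+1]$ are defined, i.e. $(p(i,j),q(i,j))$ lies in the domain of $\mathcal S_{\gamma_1}$ for $i\le m$, $j\le n+1$ and in the domain of $\mathcal S_{\gamma_2}$ for $i\le m+1$, $j\le n$. Then $F_1$ takes the value $F_1(p_0,q_0)$ on the whole rectangle, and both $u$ and $v$ satisfy the lattice SKdV equation $$\gamma_1^2(w-\hat w)(\tilde w-\hat{\tilde w})-\gamma_2^2(w-\tilde w)(\hat w-\hat{\tilde w})=0 \tag{1}$$ at $(m,n)$, where $w=w_{mn}$, $\tilde w=w_{m+1,n}$, $\hat w=w_{m,n+1}$, $\hat{\tilde w}=w_{m+1,n+1}$; for $v$ it is assumed that $u+\sqrt{-F_1}\neq0$ at these four sites. -/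

import Mathlib

namespace LSKdV

/-- The phase space `𝕜^{2N}`, a point being `(p, q) = (p₁, …, p_N, q₁, …, q_N)`. -/
abbrev Phase (𝕜 : Type*) (N : ℕ) : Type _ := (Fin N → 𝕜) × (Fin N → 𝕜)

section Maps

variable {𝕜 : Type*} [Field 𝕜] {N : ℕ}

/-- `Q_λ(ξ, η) = ∑ⱼ ξⱼ ηⱼ / (λ² - αⱼ²)`. -/
def Q (α : Fin N → 𝕜) (lam : 𝕜) (ξ η : Fin N → 𝕜) : 𝕜 :=
  ∑ j, ξ j * η j / (lam ^ 2 - α j ^ 2)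

/-- The Lax matrix `L(λ; p, q)`, where `A = diag(α₁, …, α_N)`, so that `A p = α * p`
(pointwise product). -/
def lax (α : Fin N → 𝕜) (lam : 𝕜) (x : Phase 𝕜 N) : Matrix (Fin 2) (Fin 2) 𝕜 :=
  !![lam * Q α lam x.1 x.2, 1 - Q α lam (α * x.1) x.1;
     Q α lam (α * x.2) x.2, -(lam * Q α lam x.1 x.2)]

/-- The generating function `𝓕_λ(p, q) = det L(λ; p, q)`. -/
def genF (α : Fin N → 𝕜) (lam : 𝕜) (x : Phase 𝕜 N) : 𝕜 := (lax α lam x).det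

/-- The first integral `F₁ = -⟨Aq, q⟩ - ⟨p, q⟩²`. -/
def F₁ (α : Fin N → 𝕜) (x : Phase 𝕜 N) : 𝕜 :=
  -((α * x.2) ⬝ᵥ x.2) - (x.1 ⬝ᵥ x.2) ^ 2

/-- `u = f_U(p, q) = ⟨p, q⟩` (the bilinear pairing `∑ⱼ pⱼ qⱼ`). -/
def fU (x : Phase 𝕜 N) : 𝕜 := x.1 ⬝ᵥ x.2

/-- A branch `s` of the square root: `s z` is a square root of `z` whenever `z` has one.
If `s` is such a branch then so is `-s`, so both signs of `±√` are covered. -/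
def IsSqrtBranch {K : Type*} [Field K] (s : K → K) : Prop := ∀ z, IsSquare z → s z ^ 2 = z

/-- `b = f_γ(p, q) = (-γ Q_γ(p, q) ± √(-𝓕_γ(p, q))) / Q_γ(Aq, q)`; the branch `s` of the square
root fixes the sign. -/
def fγ (α : Fin N → 𝕜) (γ : 𝕜) (s : 𝕜 → 𝕜) (x : Phase 𝕜 N) : 𝕜 :=
  (-(γ * Q α γ x.1 x.2) + s (-genF α γ x)) / Q α γ (α * x.2) x.2

/-- The domain of definition of `𝓢_γ`: the square root in `f_γ` exists in `𝕜`, the denominator of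
`f_γ` does not vanish, and `b = f_γ(p, q)` is invertible. -/
def dom (α : Fin N → 𝕜) (γ : 𝕜) (s : 𝕜 → 𝕜) : Set (Phase 𝕜 N) :=
  {x | IsSquare (-genF α γ x) ∧ Q α γ (α * x.2) x.2 ≠ 0 ∧ fγ α γ s x ≠ 0}

/-- The map `𝓢_γ : (p, q) ↦ (p̃, q̃)`,
`p̃ⱼ = (αⱼ² - γ²)^{-1/2} (αⱼ pⱼ + γ b qⱼ)`, `q̃ⱼ = (αⱼ² - γ²)^{-1/2} (γ b⁻¹ pⱼ + αⱼ qⱼ)`,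
`b = f_γ(p, q)`. Here `r j` is the chosen value of `(αⱼ² - γ²)^{1/2}` and `s` the branch of the
square root in `f_γ`. The values are meaningful on `dom α γ s`. -/
def S (α : Fin N → 𝕜) (γ : 𝕜) (r : Fin N → 𝕜) (s : 𝕜 → 𝕜) (x : Phase 𝕜 N) : Phase 𝕜 N :=
  (fun j => (r j)⁻¹ * (α j * x.1 j + γ * fγ α γ s x * x.2 j),
   fun j => (r j)⁻¹ * (γ * (fγ α γ s x)⁻¹ * x.1 j + α j * x.2 j))

end Maps

/-- `(p(m, n), q(m, n)) = T₁^m T₂^n (p₀, q₀)`. -/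
def orbit {X : Type*} (T₁ T₂ : X → X) (x₀ : X) (m n : ℕ) : X := T₁^[m] (T₂^[n] x₀)

/-- All lattice edges `(i, j) → (i+1, j)` and `(i, j) → (i, j+1)` of the rectangle
`[0, m] × [0, n]` are defined: the starting point of each edge lies in the domain of the map that
is applied along it. -/
def EdgesDefined {X : Type*} (D₁ D₂ : Set X) (y : ℕ → ℕ → X) (m n : ℕ) : Prop :=
  (∀ i j, i < m → j ≤ n → y i j ∈ D₁) ∧ (∀ i j, i ≤ m → j < n → y i j ∈ D₂)

/-- The lattice SKdV equation at the site `(m, n)`, with `u = u(m, n)`, `ũ = u(m+1, n)`,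
`û = u(m, n+1)`:
`γ₁² (u - û) (ũ - ũ̂) - γ₂² (u - ũ) (û - ũ̂) = 0`. -/
def SolvesAt {K : Type*} [Field K] (γ₁ γ₂ : K) (u : ℕ → ℕ → K) (m n : ℕ) : Prop :=
  γ₁ ^ 2 * (u m n - u m (n + 1)) * (u (m + 1) n - u (m + 1) (n + 1)) -
    γ₂ ^ 2 * (u m n - u (m + 1) n) * (u m (n + 1) - u (m + 1) (n + 1)) = 0

end LSKdV

/-! Each map acts on every pair `(pⱼ, qⱼ)` by `rⱼ⁻¹ D(αⱼ)`, where `D(λ) = !![λ, γ b; γ b⁻¹, λ]`. The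
quadratic equation for `b` (`fγ_quadratic`) yields `L(λ; x̃) D(λ) = D(λ) L(λ; x)`. Hence `𝓕_λ` is
invariant (`genF_S`), and `(b₁, -1)` is an eigenvector of `L(γ₁; x)` whose eigenvalue depends only
on `𝓕_{γ₁}`. The matrix `D₂(γ₁)` carries it to the eigenvector at `𝓢_{γ₂} x`, which determines the
new `b₁` (`fγ_S_mul`). The resulting relations on an elementary square (`fγ_square_relations`) say
that the products of the `D`'s along its two paths agree, so the maps commute. The pairing `u` drops
by `γ / b` along each edge (`fU_S`), so SKdV for `u` reduces to equality of the products of the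
`b`'s on opposite edges. As `F₁` is conserved, `v` is the image of `u` under one fixed Möbius map,
which preserves SKdV. -/

namespace LSKdV

section Field

variable {𝕜 : Type*} [Field 𝕜] {N : ℕ}

/-- The Darboux transformation `(pⱼ, qⱼ) ↦ rⱼ⁻¹ (αⱼ pⱼ + γ b qⱼ, γ b⁻¹ pⱼ + αⱼ qⱼ)` with an
arbitrary parameter `b`. -/
def darboux (α : Fin N → 𝕜) (γ : 𝕜) (r : Fin N → 𝕜) (b : 𝕜) (x : Phase 𝕜 N) : Phase 𝕜 N :=
  (fun j => (r j)⁻¹ * (α j * x.1 j + γ * b * x.2 j),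
   fun j => (r j)⁻¹ * (γ * b⁻¹ * x.1 j + α j * x.2 j))

theorem S_eq_darboux (α : Fin N → 𝕜) (γ : 𝕜) (r : Fin N → 𝕜) (s : 𝕜 → 𝕜) (x : Phase 𝕜 N) :
    S α γ r s x = darboux α γ r (fγ α γ s x) x := rfl

theorem neg_genF (α : Fin N → 𝕜) (lam : 𝕜) (x : Phase 𝕜 N) :
    -genF α lam x = lam ^ 2 * Q α lam x.1 x.2 ^ 2 +
      (1 - Q α lam (α * x.1) x.1) * Q α lam (α * x.2) x.2 := by
  rw [genF, lax, Matrix.det_fin_two_of]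
  ring

theorem mul_fγ_add {α : Fin N → 𝕜} {γ : 𝕜} {s : 𝕜 → 𝕜} {x : Phase 𝕜 N} (hx : x ∈ dom α γ s) :
    Q α γ (α * x.2) x.2 * fγ α γ s x + γ * Q α γ x.1 x.2 = s (-genF α γ x) := by
  rw [fγ, mul_div_cancel₀ _ hx.2.1]
  ring

theorem fγ_quadratic {α : Fin N → 𝕜} {γ : 𝕜} {s : 𝕜 → 𝕜} (hs : IsSqrtBranch s)
    {x : Phase 𝕜 N} (hx : x ∈ dom α γ s) :
    Q α γ (α * x.2) x.2 * fγ α γ s x ^ 2 + 2 * γ * Q α γ x.1 x.2 * fγ α γ s x =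
      1 - Q α γ (α * x.1) x.1 := by
  have h := hs _ hx.1
  rw [← mul_fγ_add hx, neg_genF] at h
  apply mul_left_cancel₀ hx.2.1
  linear_combination h

/-! ### Darboux transformations and their invariants -/

section Darboux

variable {α : Fin N → 𝕜} {γ : 𝕜} {r : Fin N → 𝕜}

theorem inv_sq_mul_of_sq_eq {γ a t : 𝕜} (hγ : a ^ 2 ≠ γ ^ 2) (ht : t ^ 2 = a ^ 2 - γ ^ 2) :
    t⁻¹ ^ 2 * (a ^ 2 - γ ^ 2) = 1 := by
  rw [inv_pow, ht, inv_mul_cancel₀ (sub_ne_zero.2 hγ)]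

/-- Turns the weights of `Q` at `λ = γ` into the factors `rⱼ⁻²` produced by the transformation, so
that identities can be checked term by term. -/
theorem inv_sub_of_sq_eq {γ a t : 𝕜} (ht : t ^ 2 = a ^ 2 - γ ^ 2) :
    (γ ^ 2 - a ^ 2)⁻¹ = -t⁻¹ ^ 2 := by
  rw [inv_pow, ht, ← inv_neg, neg_sub]

theorem fU_darboux (hγ : ∀ j, α j ^ 2 ≠ γ ^ 2) (hr : ∀ j, r j ^ 2 = α j ^ 2 - γ ^ 2)
    {b : 𝕜} (hb : b ≠ 0) {x : Phase 𝕜 N}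
    (h : Q α γ (α * x.2) x.2 * b ^ 2 + 2 * γ * Q α γ x.1 x.2 * b = 1 - Q α γ (α * x.1) x.1) :
    fU (darboux α γ r b x) = fU x - γ * b⁻¹ := by
  have hbc : b * b⁻¹ = 1 := mul_inv_cancel₀ hb
  have key : fU (darboux α γ r b x) = fU x - 2 * γ ^ 2 * Q α γ x.1 x.2
      - γ * b⁻¹ * Q α γ (α * x.1) x.1 - γ * b * Q α γ (α * x.2) x.2 := by
    simp only [fU, Q, dotProduct, darboux, Finset.mul_sum, ← Finset.sum_sub_distrib]
    refine Finset.sum_congr rfl fun j _ => ?_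
    have h1 := inv_sq_mul_of_sq_eq (hγ j) (hr j)
    simp only [Pi.mul_apply, div_eq_mul_inv, inv_sub_of_sq_eq (hr j)]
    generalize b⁻¹ = c at *
    generalize (r j)⁻¹ = t at *
    linear_combination (x.1 j * x.2 j) * h1 + t ^ 2 * γ ^ 2 * x.1 j * x.2 j * hbc
  rw [key]
  generalize b⁻¹ = c at *
  linear_combination (-γ * c) * h + (γ * b * Q α γ (α * x.2) x.2 + 2 * γ ^ 2 * Q α γ x.1 x.2) * hbc

theorem F₁_darboux (hγ : ∀ j, α j ^ 2 ≠ γ ^ 2) (hr : ∀ j, r j ^ 2 = α j ^ 2 - γ ^ 2)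
    {b : 𝕜} (hb : b ≠ 0) {x : Phase 𝕜 N}
    (h : Q α γ (α * x.2) x.2 * b ^ 2 + 2 * γ * Q α γ x.1 x.2 * b = 1 - Q α γ (α * x.1) x.1) :
    F₁ α (darboux α γ r b x) = F₁ α x := by
  have hbc : b * b⁻¹ = 1 := mul_inv_cancel₀ hb
  have key : (α * (darboux α γ r b x).2) ⬝ᵥ (darboux α γ r b x).2 = (α * x.2) ⬝ᵥ x.2
      + 2 * γ * b⁻¹ * fU x - 2 * γ ^ 3 * b⁻¹ * Q α γ x.1 x.2
      - γ ^ 2 * b⁻¹ ^ 2 * Q α γ (α * x.1) x.1 - γ ^ 2 * Q α γ (α * x.2) x.2 := by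
    simp only [fU, Q, dotProduct, darboux, Finset.mul_sum, ← Finset.sum_sub_distrib,
      ← Finset.sum_add_distrib]
    refine Finset.sum_congr rfl fun j _ => ?_
    have h1 := inv_sq_mul_of_sq_eq (hγ j) (hr j)
    simp only [Pi.mul_apply, div_eq_mul_inv, inv_sub_of_sq_eq (hr j)]
    generalize b⁻¹ = c at *
    generalize (r j)⁻¹ = t at *
    linear_combination (α j * x.2 j ^ 2 + 2 * γ * c * x.1 j * x.2 j) * h1
  have hU := fU_darboux hγ hr hb h
  rw [F₁, F₁, key]
  change _ - fU _ ^ 2 = _ - fU _ ^ 2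
  rw [hU]
  generalize b⁻¹ = c at *
  linear_combination (γ ^ 2 * c ^ 2) * h -
    (γ ^ 2 * Q α γ (α * x.2) x.2 * (b * c + 1) + 2 * γ ^ 3 * c * Q α γ x.1 x.2) * hbc

section Intertwining

variable {lam : 𝕜} {b : 𝕜} {x : Phase 𝕜 N}

/-- The upper left entry of `L(λ; x̃) D(λ) = D(λ) L(λ; x)`, where
`D(λ) = !![λ, γ b; γ b⁻¹, λ]`. -/
theorem intertwine_zero_zero (hlam : ∀ j, α j ^ 2 ≠ lam ^ 2)
    (hγ : ∀ j, α j ^ 2 ≠ γ ^ 2) (hr : ∀ j, r j ^ 2 = α j ^ 2 - γ ^ 2) (hb : b ≠ 0)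
    (h : Q α γ (α * x.2) x.2 * b ^ 2 + 2 * γ * Q α γ x.1 x.2 * b = 1 - Q α γ (α * x.1) x.1) :
    lam ^ 2 * Q α lam (darboux α γ r b x).1 (darboux α γ r b x).2 +
      (1 - Q α lam (α * (darboux α γ r b x).1) (darboux α γ r b x).1) * (γ * b⁻¹) =
    lam ^ 2 * Q α lam x.1 x.2 + γ * b * Q α lam (α * x.2) x.2 := by
  have hbc : b * b⁻¹ = 1 := mul_inv_cancel₀ hb
  -- Termwise identity valid for every `b ≠ 0`: the pairings arise from `λ² / (λ² - αⱼ²) = 1 + αⱼ² /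
  -- (λ² - αⱼ²)`. The quadratic enters only through the shift of `fU`.
  have key : lam ^ 2 * Q α lam (darboux α γ r b x).1 (darboux α γ r b x).2 -
      γ * b⁻¹ * Q α lam (α * (darboux α γ r b x).1) (darboux α γ r b x).1
      - fU (darboux α γ r b x) =
      lam ^ 2 * Q α lam x.1 x.2 + γ * b * Q α lam (α * x.2) x.2 - fU x := by
    simp only [fU, Q, dotProduct, darboux, Finset.mul_sum, ← Finset.sum_sub_distrib,
      ← Finset.sum_add_distrib]
    refine Finset.sum_congr rfl fun j _ => ?_
    have h1 := inv_sq_mul_of_sq_eq (hγ j) (hr j)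
    have h2 : (lam ^ 2 - α j ^ 2)⁻¹ * (lam ^ 2 - α j ^ 2) = 1 :=
      inv_mul_cancel₀ (sub_ne_zero.2 (hlam j).symm)
    simp only [Pi.mul_apply, div_eq_mul_inv]
    generalize (lam ^ 2 - α j ^ 2)⁻¹ = l at *
    generalize b⁻¹ = c at *
    generalize (r j)⁻¹ = t at *
    linear_combination (t ^ 2 * (α j * x.1 j + γ * b * x.2 j) * (γ * c * x.1 j + α j * x.2 j) -
      x.1 j * x.2 j) * h2 + (α j * l * (α j * x.1 j + γ * b * x.2 j) * x.2 j) * h1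
      - (t ^ 2 * l * α j * γ ^ 2 * x.2 j * (α j * x.1 j + γ * b * x.2 j)) * hbc
  linear_combination key + fU_darboux hγ hr hb h

/-- The upper right entry of `L(λ; x̃) D(λ) = D(λ) L(λ; x)`, divided by `λ`. -/
theorem intertwine_zero_one
    (hγ : ∀ j, α j ^ 2 ≠ γ ^ 2) (hr : ∀ j, r j ^ 2 = α j ^ 2 - γ ^ 2) (hb : b ≠ 0) :
    γ * b * Q α lam (darboux α γ r b x).1 (darboux α γ r b x).2 +
      (1 - Q α lam (α * (darboux α γ r b x).1) (darboux α γ r b x).1) =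
    1 - Q α lam (α * x.1) x.1 - γ * b * Q α lam x.1 x.2 := by
  have hbc : b * b⁻¹ = 1 := mul_inv_cancel₀ hb
  have key : γ * b * Q α lam (darboux α γ r b x).1 (darboux α γ r b x).2 -
      Q α lam (α * (darboux α γ r b x).1) (darboux α γ r b x).1 +
      Q α lam (α * x.1) x.1 + γ * b * Q α lam x.1 x.2 = 0 := by
    simp only [Q, darboux, Finset.mul_sum, ← Finset.sum_sub_distrib, ← Finset.sum_add_distrib]
    refine Finset.sum_eq_zero fun j _ => ?_
    have h1 := inv_sq_mul_of_sq_eq (hγ j) (hr j)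
    simp only [Pi.mul_apply, div_eq_mul_inv]
    generalize (lam ^ 2 - α j ^ 2)⁻¹ = l at *
    generalize b⁻¹ = c at *
    generalize (r j)⁻¹ = t at *
    linear_combination (-l * (α j * x.1 j + γ * b * x.2 j) * x.1 j) * h1
      + (t ^ 2 * l * γ ^ 2 * x.1 j * (α j * x.1 j + γ * b * x.2 j)) * hbc
  linear_combination key

/-- The lower left entry of `L(λ; x̃) D(λ) = D(λ) L(λ; x)`, divided by `λ`. -/
theorem intertwine_one_zero
    (hγ : ∀ j, α j ^ 2 ≠ γ ^ 2) (hr : ∀ j, r j ^ 2 = α j ^ 2 - γ ^ 2) (hb : b ≠ 0) :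
    Q α lam (α * (darboux α γ r b x).2) (darboux α γ r b x).2 -
      γ * b⁻¹ * Q α lam (darboux α γ r b x).1 (darboux α γ r b x).2 =
    γ * b⁻¹ * Q α lam x.1 x.2 + Q α lam (α * x.2) x.2 := by
  have hbc : b * b⁻¹ = 1 := mul_inv_cancel₀ hb
  simp only [Q, darboux, Finset.mul_sum, ← Finset.sum_sub_distrib, ← Finset.sum_add_distrib]
  refine Finset.sum_congr rfl fun j _ => ?_
  have h1 := inv_sq_mul_of_sq_eq (hγ j) (hr j)
  simp only [Pi.mul_apply, div_eq_mul_inv]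
  generalize (lam ^ 2 - α j ^ 2)⁻¹ = l at *
  generalize b⁻¹ = c at *
  generalize (r j)⁻¹ = t at *
  linear_combination (l * (γ * c * x.1 j + α j * x.2 j) * x.2 j) * h1
    - (t ^ 2 * l * γ ^ 2 * x.2 j * (γ * c * x.1 j + α j * x.2 j)) * hbc

theorem genF_darboux (hlam : ∀ j, α j ^ 2 ≠ lam ^ 2)
    (hγ : ∀ j, α j ^ 2 ≠ γ ^ 2) (hr : ∀ j, r j ^ 2 = α j ^ 2 - γ ^ 2) (hb : b ≠ 0)
    (h : Q α γ (α * x.2) x.2 * b ^ 2 + 2 * γ * Q α γ x.1 x.2 * b = 1 - Q α γ (α * x.1) x.1) :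
    genF α lam (darboux α γ r b x) = genF α lam x := by
  have E1 := intertwine_zero_zero hlam hγ hr hb h
  have E2 := intertwine_zero_one (lam := lam) (x := x) hγ hr hb
  have E3 := intertwine_one_zero (lam := lam) (x := x) hγ hr hb
  rw [← neg_inj, neg_genF, neg_genF]
  set y := darboux α γ r b x
  generalize 1 - Q α lam (α * y.1) y.1 = P' at *
  generalize 1 - Q α lam (α * x.1) x.1 = P at *
  generalize Q α lam (α * y.2) y.2 = R' at *
  generalize Q α lam (α * x.2) x.2 = R at *
  generalize Q α lam y.1 y.2 = a' at *
  generalize Q α lam x.1 x.2 = a at *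
  obtain rfl : P' = P - γ * b * a - γ * b * a' := by linear_combination E2
  obtain rfl : R' = R + γ * b⁻¹ * a + γ * b⁻¹ * a' := by linear_combination E3
  generalize b⁻¹ = c at *
  -- Factoring out `a' + a` avoids taking determinants and dividing by `det D(λ) = λ² - γ²`, so `λ²
  -- = γ²` is allowed.
  linear_combination (a' + a) * E1

end Intertwining

/-- Two Darboux transformations with the same `γ b` and `γ b⁻¹` differ by signs only. -/
theorem Q_darboux_congr {γ' b b' : 𝕜} {r' : Fin N → 𝕜} {x : Phase 𝕜 N}
    (hr : ∀ j, r j ^ 2 = r' j ^ 2) (h1 : γ * b = γ' * b') (h2 : γ * b⁻¹ = γ' * b'⁻¹) (lam : 𝕜) :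
    Q α lam (darboux α γ r b x).1 (darboux α γ r b x).2 =
      Q α lam (darboux α γ' r' b' x).1 (darboux α γ' r' b' x).2 ∧
    Q α lam (α * (darboux α γ r b x).1) (darboux α γ r b x).1 =
      Q α lam (α * (darboux α γ' r' b' x).1) (darboux α γ' r' b' x).1 ∧
    Q α lam (α * (darboux α γ r b x).2) (darboux α γ r b x).2 =
      Q α lam (α * (darboux α γ' r' b' x).2) (darboux α γ' r' b' x).2 := by
  have h (j) : (r j)⁻¹ ^ 2 = (r' j)⁻¹ ^ 2 := by rw [inv_pow, inv_pow, hr]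
  simp only [Q, darboux, h1, h2, Pi.mul_apply]
  refine ⟨?_, ?_, ?_⟩ <;> refine Finset.sum_congr rfl fun j _ => congrArg (· / _) ?_
  · linear_combination ((α j * x.1 j + γ' * b' * x.2 j) *
      (γ' * b'⁻¹ * x.1 j + α j * x.2 j)) * h j
  · linear_combination (α j * (α j * x.1 j + γ' * b' * x.2 j) ^ 2) * h j
  · linear_combination (α j * (γ' * b'⁻¹ * x.1 j + α j * x.2 j) ^ 2) * h j

end Darboux

/-! ### Commutation and SKdV on an elementary square -/

section Commutation

variable {α : Fin N → 𝕜} {γ γ₁ γ₂ : 𝕜} {r r₁ r₂ : Fin N → 𝕜} {s s₁ s₂ : 𝕜 → 𝕜} {x : Phase 𝕜 N}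

theorem fU_S (hγ : ∀ j, α j ^ 2 ≠ γ ^ 2) (hr : ∀ j, r j ^ 2 = α j ^ 2 - γ ^ 2)
    (hs : IsSqrtBranch s) (hx : x ∈ dom α γ s) :
    fU (S α γ r s x) = fU x - γ * (fγ α γ s x)⁻¹ :=
  fU_darboux hγ hr hx.2.2 (fγ_quadratic hs hx)

theorem F₁_S (hγ : ∀ j, α j ^ 2 ≠ γ ^ 2) (hr : ∀ j, r j ^ 2 = α j ^ 2 - γ ^ 2)
    (hs : IsSqrtBranch s) (hx : x ∈ dom α γ s) : F₁ α (S α γ r s x) = F₁ α x :=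
  F₁_darboux hγ hr hx.2.2 (fγ_quadratic hs hx)

theorem genF_S {lam : 𝕜} (hlam : ∀ j, α j ^ 2 ≠ lam ^ 2) (hγ : ∀ j, α j ^ 2 ≠ γ ^ 2)
    (hr : ∀ j, r j ^ 2 = α j ^ 2 - γ ^ 2)
    (hs : IsSqrtBranch s) (hx : x ∈ dom α γ s) : genF α lam (S α γ r s x) = genF α lam x :=
  genF_darboux hlam hγ hr hx.2.2 (fγ_quadratic hs hx)

/-- `D₂(γ₁)` maps the eigenvector `(b₁, -1)` of `L(γ₁; x)` to a multiple of the corresponding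
eigenvector of `L(γ₁; 𝓢_{γ₂} x)`. -/
theorem fγ_S_mul (hγ₁ : ∀ j, α j ^ 2 ≠ γ₁ ^ 2) (hγ₂ : ∀ j, α j ^ 2 ≠ γ₂ ^ 2)
    (hr₂ : ∀ j, r₂ j ^ 2 = α j ^ 2 - γ₂ ^ 2) (hs₁ : IsSqrtBranch s₁) (hs₂ : IsSqrtBranch s₂)
    (hx₁ : x ∈ dom α γ₁ s₁) (hx₂ : x ∈ dom α γ₂ s₂) (hx₂₁ : S α γ₂ r₂ s₂ x ∈ dom α γ₁ s₁) :
    fγ α γ₁ s₁ (S α γ₂ r₂ s₂ x) * (γ₁ * fγ α γ₂ s₂ x - γ₂ * fγ α γ₁ s₁ x) =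
      fγ α γ₂ s₂ x * (γ₁ * fγ α γ₁ s₁ x - γ₂ * fγ α γ₂ s₂ x) := by
  have hquad := fγ_quadratic hs₁ hx₁
  have hquad₂ := fγ_quadratic hs₂ hx₂
  have hlin := mul_fγ_add hx₁
  have hlin' := mul_fγ_add hx₂₁
  -- Equal values of `𝓕_{γ₁}` give the same root under the fixed branch, hence the same eigenvalue
  -- at both points.
  rw [genF_S hγ₁ hγ₂ hr₂ hs₂ hx₂, ← hlin] at hlin'
  have E1 := intertwine_zero_zero hγ₁ hγ₂ hr₂ hx₂.2.2 hquad₂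
  have E2 := intertwine_zero_one (lam := γ₁) (x := x) hγ₂ hr₂ hx₂.2.2
  have E3 := intertwine_one_zero (lam := γ₁) (x := x) hγ₂ hr₂ hx₂.2.2
  rw [← S_eq_darboux] at E1 E2 E3
  apply mul_left_cancel₀ hx₂₁.2.1
  have hbc : fγ α γ₂ s₂ x * (fγ α γ₂ s₂ x)⁻¹ = 1 := mul_inv_cancel₀ hx₂.2.2
  clear hlin hquad₂
  set y := S α γ₂ r₂ s₂ x
  generalize fγ α γ₁ s₁ y = b₁' at *
  generalize fγ α γ₁ s₁ x = b₁ at *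
  generalize fγ α γ₂ s₂ x = b₂ at *
  generalize 1 - Q α γ₁ (α * y.1) y.1 = P' at *
  generalize 1 - Q α γ₁ (α * x.1) x.1 = P at *
  generalize Q α γ₁ (α * y.2) y.2 = R' at *
  generalize Q α γ₁ (α * x.2) x.2 = R at *
  generalize Q α γ₁ y.1 y.2 = a' at *
  generalize Q α γ₁ x.1 x.2 = a at *
  generalize b₂⁻¹ = c at *
  obtain rfl : R' = R + γ₂ * c * a + γ₂ * c * a' := by linear_combination E3
  obtain rfl : P' = P - γ₂ * b₂ * a - γ₂ * b₂ * a' := by linear_combination E2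
  linear_combination (γ₁ * b₂ - γ₂ * b₁) * hlin' - b₂ * E1 - b₂ * γ₂ * c * hquad +
    (R * b₁ + γ₁ * a - γ₁ * a') * γ₂ * b₁ * hbc

/-- The degenerate case in which both sides of `fγ_S_mul` vanish. The two images of `x` then differ
only by signs of their components and have equal `Q` values, so the new parameters follow from the
conserved roots. -/
theorem fγ_S_of_sq_eq_one {ε : 𝕜} (hε : ε ^ 2 = 1) (hγ : γ₂ = ε * γ₁)
    (hγ₁ : ∀ j, α j ^ 2 ≠ γ₁ ^ 2) (hγ₂ : ∀ j, α j ^ 2 ≠ γ₂ ^ 2)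
    (hr₁ : ∀ j, r₁ j ^ 2 = α j ^ 2 - γ₁ ^ 2)
    (hr₂ : ∀ j, r₂ j ^ 2 = α j ^ 2 - γ₂ ^ 2) (hs₁ : IsSqrtBranch s₁) (hs₂ : IsSqrtBranch s₂)
    (hx₁ : x ∈ dom α γ₁ s₁) (hx₂ : x ∈ dom α γ₂ s₂) (hx₂₁ : S α γ₂ r₂ s₂ x ∈ dom α γ₁ s₁)
    (hx₁₂ : S α γ₁ r₁ s₁ x ∈ dom α γ₂ s₂) (hb : fγ α γ₂ s₂ x = ε * fγ α γ₁ s₁ x) :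
    fγ α γ₂ s₂ (S α γ₁ r₁ s₁ x) = ε * fγ α γ₁ s₁ (S α γ₂ r₂ s₂ x) := by
  have hsq : γ₂ ^ 2 = γ₁ ^ 2 := by rw [hγ, mul_pow, hε, one_mul]
  have hQ (ξ η : Fin N → 𝕜) : Q α γ₂ ξ η = Q α γ₁ ξ η := by simp only [Q, hsq]
  have hεinv : ε⁻¹ = ε := inv_eq_of_mul_eq_one_left (by rw [← sq, hε])
  obtain ⟨q1, -, q3⟩ := Q_darboux_congr (α := α) (γ := γ₂) (γ' := γ₁) (b := fγ α γ₂ s₂ x)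
    (b' := fγ α γ₁ s₁ x) (r := r₂) (r' := r₁) (x := x) (fun j => by rw [hr₁, hr₂, hsq])
    (by rw [hb, hγ]; linear_combination γ₁ * fγ α γ₁ s₁ x * hε)
    (by rw [hb, hγ, mul_inv, hεinv]; linear_combination γ₁ * (fγ α γ₁ s₁ x)⁻¹ * hε) γ₁
  rw [← S_eq_darboux, ← S_eq_darboux] at q1 q3
  have l1 := mul_fγ_add hx₁
  have l2 := mul_fγ_add hx₂
  have l1' := mul_fγ_add hx₂₁
  have l2' := mul_fγ_add hx₁₂
  rw [genF_S hγ₁ hγ₂ hr₂ hs₂ hx₂, ← l1, q1, q3] at l1'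
  rw [genF_S hγ₂ hγ₁ hr₁ hs₁ hx₁, ← l2, hb, hQ, hQ, hQ, hQ] at l2'
  have hne := hx₁₂.2.1
  rw [hQ] at hne
  apply mul_left_cancel₀ hne
  linear_combination l2' - ε * l1' +
    (Q α γ₁ x.1 x.2 - Q α γ₁ (S α γ₁ r₁ s₁ x).1 (S α γ₁ r₁ s₁ x).2) * hγ

/-- The relations between the parameters `b` on the four edges of an elementary square. -/
theorem fγ_square_relations (hγ₁ : ∀ j, α j ^ 2 ≠ γ₁ ^ 2) (hγ₂ : ∀ j, α j ^ 2 ≠ γ₂ ^ 2)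
    (hγ : γ₁ ≠ 0 ∨ γ₂ ≠ 0) (hr₁ : ∀ j, r₁ j ^ 2 = α j ^ 2 - γ₁ ^ 2)
    (hr₂ : ∀ j, r₂ j ^ 2 = α j ^ 2 - γ₂ ^ 2) (hs₁ : IsSqrtBranch s₁) (hs₂ : IsSqrtBranch s₂)
    (hx₁ : x ∈ dom α γ₁ s₁) (hx₂ : x ∈ dom α γ₂ s₂) (hx₂₁ : S α γ₂ r₂ s₂ x ∈ dom α γ₁ s₁)
    (hx₁₂ : S α γ₁ r₁ s₁ x ∈ dom α γ₂ s₂) :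
    fγ α γ₁ s₁ x * fγ α γ₁ s₁ (S α γ₂ r₂ s₂ x) = fγ α γ₂ s₂ x * fγ α γ₂ s₂ (S α γ₁ r₁ s₁ x) ∧
    γ₁ * fγ α γ₁ s₁ x + γ₂ * fγ α γ₂ s₂ (S α γ₁ r₁ s₁ x) =
      γ₂ * fγ α γ₂ s₂ x + γ₁ * fγ α γ₁ s₁ (S α γ₂ r₂ s₂ x) := by
  have K1 := fγ_S_mul hγ₁ hγ₂ hr₂ hs₁ hs₂ hx₁ hx₂ hx₂₁
  have K2 := fγ_S_mul hγ₂ hγ₁ hr₁ hs₂ hs₁ hx₂ hx₁ hx₁₂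
  have hdeg (ε : 𝕜) (hε : ε ^ 2 = 1) (h : γ₂ = ε * γ₁) :=
    fγ_S_of_sq_eq_one hε h hγ₁ hγ₂ hr₁ hr₂ hs₁ hs₂ hx₁ hx₂ hx₂₁ hx₁₂
  have hb₁ := hx₁.2.2
  have hb₂ := hx₂.2.2
  generalize fγ α γ₁ s₁ (S α γ₂ r₂ s₂ x) = b₁' at *
  generalize fγ α γ₂ s₂ (S α γ₁ r₁ s₁ x) = b₂' at *
  generalize fγ α γ₁ s₁ x = b₁ at *
  generalize fγ α γ₂ s₂ x = b₂ at *
  by_cases h : γ₁ * b₂ - γ₂ * b₁ = 0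
  -- Together with `h` this forces `b₂ / b₁ = ±1`, the sign relating `γ₂` to `γ₁`.
  · have h' : γ₁ * b₁ - γ₂ * b₂ = 0 := by
      rw [h, mul_zero] at K1
      exact (mul_eq_zero.1 K1.symm).resolve_left hb₂
    have hg₁ : γ₁ ≠ 0 := by
      rintro rfl
      have : γ₂ * b₂ = 0 := by linear_combination -h'
      exact hγ.elim (fun h => h rfl) fun hg => mul_ne_zero hg hb₂ this
    have hε : (b₂ / b₁) ^ 2 = 1 := by
      have : γ₁ * (b₂ ^ 2 - b₁ ^ 2) = 0 := by linear_combination b₂ * h - b₁ * h'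
      rw [div_pow, div_eq_one_iff_eq (pow_ne_zero 2 hb₁)]
      exact sub_eq_zero.1 ((mul_eq_zero.1 this).resolve_left hg₁)
    have hbε : b₂ = b₂ / b₁ * b₁ := (div_mul_cancel₀ _ hb₁).symm
    have hγε : γ₂ = b₂ / b₁ * γ₁ := by
      rw [div_mul_eq_mul_div, eq_div_iff hb₁]
      linear_combination -h
    have hb' := hdeg _ hε hγε hbε
    generalize b₂ / b₁ = ε at *
    subst hb' hbε hγε
    constructor
    · linear_combination (-b₁ * b₁') * hε
    · linear_combination (γ₁ * b₁' - γ₁ * b₁) * hε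
  · have p1 : b₁ * b₁' = b₂ * b₂' := by
      apply mul_left_cancel₀ h
      linear_combination b₁ * K1 + b₂ * K2
    refine ⟨p1, ?_⟩
    apply mul_left_cancel₀ h
    linear_combination (-γ₁) * K1 - γ₂ * K2

theorem S_comm (hγ₁ : ∀ j, α j ^ 2 ≠ γ₁ ^ 2) (hγ₂ : ∀ j, α j ^ 2 ≠ γ₂ ^ 2)
    (hr₁ : ∀ j, r₁ j ^ 2 = α j ^ 2 - γ₁ ^ 2)
    (hr₂ : ∀ j, r₂ j ^ 2 = α j ^ 2 - γ₂ ^ 2) (hs₁ : IsSqrtBranch s₁) (hs₂ : IsSqrtBranch s₂)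
    (hx₁ : x ∈ dom α γ₁ s₁) (hx₂ : x ∈ dom α γ₂ s₂) (hx₂₁ : S α γ₂ r₂ s₂ x ∈ dom α γ₁ s₁)
    (hx₁₂ : S α γ₁ r₁ s₁ x ∈ dom α γ₂ s₂) :
    S α γ₁ r₁ s₁ (S α γ₂ r₂ s₂ x) = S α γ₂ r₂ s₂ (S α γ₁ r₁ s₁ x) := by
  by_cases hγ : γ₁ = 0 ∧ γ₂ = 0
  · obtain ⟨rfl, rfl⟩ := hγ
    ext j <;> simp only [S] <;> ring
  obtain ⟨p, q⟩ := fγ_square_relations hγ₁ hγ₂ (not_and_or.1 hγ) hr₁ hr₂ hs₁ hs₂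
    hx₁ hx₂ hx₂₁ hx₁₂
  have n1 := hx₁.2.2
  have n2 := hx₂.2.2
  have n1' := hx₂₁.2.2
  have n2' := hx₁₂.2.2
  rw [S_eq_darboux α γ₁ r₁ s₁ (S α γ₂ r₂ s₂ x), S_eq_darboux α γ₂ r₂ s₂ (S α γ₁ r₁ s₁ x)]
  generalize fγ α γ₁ s₁ (S α γ₂ r₂ s₂ x) = b₁' at *
  generalize fγ α γ₂ s₂ (S α γ₁ r₁ s₁ x) = b₂' at *
  rw [S_eq_darboux, S_eq_darboux]
  generalize fγ α γ₁ s₁ x = b₁ at *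
  generalize fγ α γ₂ s₂ x = b₂ at *
  -- With `q`, the facts `e1`, `e2`, `e3` are the entries of `D₁' D₂ = D₂' D₁`.
  have e1 : b₁' * b₂⁻¹ = b₂' * b₁⁻¹ := by
    rw [← div_eq_mul_inv, ← div_eq_mul_inv, div_eq_div_iff n2 n1]
    linear_combination p
  have e2 : b₁'⁻¹ * b₂ = b₂'⁻¹ * b₁ := by
    simpa [mul_comm] using congrArg (·⁻¹) e1
  have e3 : γ₂ * b₂⁻¹ + γ₁ * b₁'⁻¹ = γ₁ * b₁⁻¹ + γ₂ * b₂'⁻¹ := by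
    have i1 : b₂⁻¹ = b₂' * (b₁ * b₁')⁻¹ := by
      rw [p, mul_inv, mul_left_comm, mul_inv_cancel₀ n2', mul_one]
    have i2 : b₂'⁻¹ = b₂ * (b₁ * b₁')⁻¹ := by
      rw [p, mul_inv, mul_inv_cancel_left₀ n2]
    have i3 : b₁⁻¹ = b₁' * (b₁ * b₁')⁻¹ := by
      rw [mul_inv, mul_left_comm, mul_inv_cancel₀ n1', mul_one]
    have i4 : b₁'⁻¹ = b₁ * (b₁ * b₁')⁻¹ := by
      rw [mul_inv, mul_inv_cancel_left₀ n1]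
    rw [i1, i2, i3, i4]
    linear_combination (b₁ * b₁')⁻¹ * q
  ext j <;> simp only [darboux]
  · linear_combination (r₁ j)⁻¹ * (r₂ j)⁻¹ * (γ₁ * γ₂ * x.1 j * e1 - α j * x.2 j * q)
  · linear_combination (r₁ j)⁻¹ * (r₂ j)⁻¹ * (γ₁ * γ₂ * x.2 j * e2 + α j * x.1 j * e3)

/-- The lattice SKdV equation for `u` on an elementary square. -/
theorem fU_square (hγ₁ : ∀ j, α j ^ 2 ≠ γ₁ ^ 2) (hγ₂ : ∀ j, α j ^ 2 ≠ γ₂ ^ 2)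
    (hr₁ : ∀ j, r₁ j ^ 2 = α j ^ 2 - γ₁ ^ 2)
    (hr₂ : ∀ j, r₂ j ^ 2 = α j ^ 2 - γ₂ ^ 2) (hs₁ : IsSqrtBranch s₁) (hs₂ : IsSqrtBranch s₂)
    (hx₁ : x ∈ dom α γ₁ s₁) (hx₂ : x ∈ dom α γ₂ s₂) (hx₂₁ : S α γ₂ r₂ s₂ x ∈ dom α γ₁ s₁)
    (hx₁₂ : S α γ₁ r₁ s₁ x ∈ dom α γ₂ s₂) :
    γ₁ ^ 2 * (fU x - fU (S α γ₂ r₂ s₂ x)) *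
        (fU (S α γ₁ r₁ s₁ x) - fU (S α γ₂ r₂ s₂ (S α γ₁ r₁ s₁ x))) -
      γ₂ ^ 2 * (fU x - fU (S α γ₁ r₁ s₁ x)) *
        (fU (S α γ₂ r₂ s₂ x) - fU (S α γ₁ r₁ s₁ (S α γ₂ r₂ s₂ x))) = 0 := by
  rw [fU_S hγ₂ hr₂ hs₂ hx₁₂, fU_S hγ₁ hr₁ hs₁ hx₂₁, fU_S hγ₁ hr₁ hs₁ hx₁, fU_S hγ₂ hr₂ hs₂ hx₂]
  by_cases hγ : γ₁ = 0 ∧ γ₂ = 0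
  · obtain ⟨rfl, rfl⟩ := hγ
    ring
  have p := congrArg (·⁻¹) (fγ_square_relations hγ₁ hγ₂ (not_and_or.1 hγ) hr₁ hr₂ hs₁ hs₂
    hx₁ hx₂ hx₂₁ hx₁₂).1
  simp only [mul_inv] at p
  linear_combination (-γ₁ ^ 2 * γ₂ ^ 2) * p

end Commutation

/-- The lattice SKdV equation is invariant under the Möbius transformation
`w ↦ (w - ρ) / (w + ρ)`. -/
theorem skdv_moebius {g₁ g₂ w w₁ w₂ w₁₂ ρ : 𝕜} (h : w + ρ ≠ 0) (h₁ : w₁ + ρ ≠ 0)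
    (h₂ : w₂ + ρ ≠ 0) (h₁₂ : w₁₂ + ρ ≠ 0)
    (H : g₁ ^ 2 * (w - w₂) * (w₁ - w₁₂) - g₂ ^ 2 * (w - w₁) * (w₂ - w₁₂) = 0) :
    g₁ ^ 2 * ((w - ρ) / (w + ρ) - (w₂ - ρ) / (w₂ + ρ)) *
        ((w₁ - ρ) / (w₁ + ρ) - (w₁₂ - ρ) / (w₁₂ + ρ)) -
      g₂ ^ 2 * ((w - ρ) / (w + ρ) - (w₁ - ρ) / (w₁ + ρ)) *
        ((w₂ - ρ) / (w₂ + ρ) - (w₁₂ - ρ) / (w₁₂ + ρ)) = 0 := by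
  -- Each product of two differences involves all four sites once, so both terms acquire the same
  -- factor.
  have key (a b : 𝕜) (ha : a + ρ ≠ 0) (hb : b + ρ ≠ 0) :
      (a - ρ) / (a + ρ) - (b - ρ) / (b + ρ) = 2 * ρ * (a - b) * ((a + ρ)⁻¹ * (b + ρ)⁻¹) := by
    rw [div_sub_div _ _ ha hb, div_eq_mul_inv, mul_inv]
    ring
  rw [key _ _ h h₂, key _ _ h₁ h₁₂, key _ _ h h₁, key _ _ h₂ h₁₂]
  linear_combination
    (4 * ρ ^ 2 * ((w + ρ)⁻¹ * (w₁ + ρ)⁻¹ * (w₂ + ρ)⁻¹ * (w₁₂ + ρ)⁻¹)) * H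

end Field

/-! ### Lattice orbits of two maps -/

section Orbit

variable {X : Type*} {T₁ T₂ : X → X} {D₁ D₂ : Set X} {x₀ : X} {m n : ℕ}

theorem orbit_succ_left (i j : ℕ) :
    orbit T₁ T₂ x₀ (i + 1) j = T₁ (orbit T₁ T₂ x₀ i j) :=
  Function.iterate_succ_apply' _ _ _

/-- `T₂` acts innermost in `orbit`, so it must be moved past every `T₁`, one square at a time; the
edge hypotheses supply the domain conditions for each square. -/
theorem orbit_succ_right (hcomm : ∀ x, x ∈ D₁ → T₁ x ∈ D₂ → x ∈ D₂ → T₂ x ∈ D₁ →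
      T₁ (T₂ x) = T₂ (T₁ x))
    (hE : EdgesDefined D₁ D₂ (orbit T₁ T₂ x₀) m n) {i j : ℕ} (hi : i ≤ m) (hj : j < n) :
    orbit T₁ T₂ x₀ i (j + 1) = T₂ (orbit T₁ T₂ x₀ i j) := by
  induction i with
  | zero => exact Function.iterate_succ_apply' _ _ _
  | succ i ih =>
    have ih := ih (by omega)
    have h₁₂ := hE.2 (i + 1) j hi hj
    have h₂₁ := hE.1 i (j + 1) (by omega) (by omega)
    rw [orbit_succ_left] at h₁₂
    rw [ih] at h₂₁
    rw [orbit_succ_left, orbit_succ_left, ih]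
    exact hcomm _ (hE.1 i j (by omega) (by omega)) h₁₂ (hE.2 i j (by omega) hj) h₂₁

theorem orbit_invariant {Y : Type*} {F : X → Y} (hF₁ : ∀ x ∈ D₁, F (T₁ x) = F x)
    (hF₂ : ∀ x ∈ D₂, F (T₂ x) = F x)
    (hE : EdgesDefined D₁ D₂ (orbit T₁ T₂ x₀) m n) {i j : ℕ} (hi : i ≤ m) (hj : j ≤ n) :
    F (orbit T₁ T₂ x₀ i j) = F x₀ := by
  induction i with
  | zero =>
    induction j with
    | zero => rfl
    | succ j ih =>
      rw [← ih (by omega), ← hF₂ _ (hE.2 0 j hi (by omega))]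
      exact congrArg F (Function.iterate_succ_apply' _ _ _)
  | succ i ih =>
    rw [orbit_succ_left, hF₁ _ (hE.1 i j (by omega) hj), ih (by omega)]

end Orbit

end LSKdV

/-! ### The main theorem -/

theorem proposition4p1
    {𝕜 : Type*} [RCLike 𝕜] [Algebra 𝕜 ℂ] {N : ℕ}
    (α : Fin N → 𝕜) (hα : ∀ j, α j ≠ 0) (hα_inj : Function.Injective fun j => α j ^ 2)
    (γ₁ γ₂ : 𝕜)
    (hγ₁ : ∀ j, α j ^ 2 ≠ γ₁ ^ 2) (hγ₂ : ∀ j, α j ^ 2 ≠ γ₂ ^ 2)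
    -- the chosen square roots of `αⱼ² - γ²` for the two maps
    (r₁ r₂ : Fin N → 𝕜)
    (hr₁ : ∀ j, r₁ j ^ 2 = α j ^ 2 - γ₁ ^ 2) (hr₂ : ∀ j, r₂ j ^ 2 = α j ^ 2 - γ₂ ^ 2)
    -- the chosen branches of `√(-𝓕_γ)` for the two maps, and of `√(-F₁)` over `ℂ`
    (s₁ s₂ : 𝕜 → 𝕜) (s : ℂ → ℂ)
    (hs₁ : LSKdV.IsSqrtBranch s₁) (hs₂ : LSKdV.IsSqrtBranch s₂) (hs : LSKdV.IsSqrtBranch s) :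
    -- the maps commute wherever both compositions are defined
    (∀ x : LSKdV.Phase 𝕜 N,
      x ∈ LSKdV.dom α γ₁ s₁ → LSKdV.S α γ₁ r₁ s₁ x ∈ LSKdV.dom α γ₂ s₂ →
      x ∈ LSKdV.dom α γ₂ s₂ → LSKdV.S α γ₂ r₂ s₂ x ∈ LSKdV.dom α γ₁ s₁ →
      LSKdV.S α γ₁ r₁ s₁ (LSKdV.S α γ₂ r₂ s₂ x) = LSKdV.S α γ₂ r₂ s₂ (LSKdV.S α γ₁ r₁ s₁ x)) ∧
    ∀ (x₀ : LSKdV.Phase 𝕜 N) (y : ℕ → ℕ → LSKdV.Phase 𝕜 N) (u : ℕ → ℕ → 𝕜)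
      (ρ v : ℕ → ℕ → ℂ),
      y = LSKdV.orbit (LSKdV.S α γ₁ r₁ s₁) (LSKdV.S α γ₂ r₂ s₂) x₀ →
      (∀ m n, u m n = LSKdV.fU (y m n)) →
      (∀ m n, ρ m n = s (-algebraMap 𝕜 ℂ (LSKdV.F₁ α (y m n)))) →
      (∀ m n, v m n = (algebraMap 𝕜 ℂ (u m n) - ρ m n) / (algebraMap 𝕜 ℂ (u m n) + ρ m n)) →
      ∀ m n, LSKdV.EdgesDefined (LSKdV.dom α γ₁ s₁) (LSKdV.dom α γ₂ s₂) y (m + 1) (n + 1) →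
        -- `F₁` has the same value at all points of the rectangle, so that `ρ = √(-F₁)` is constant
        (∀ i j, i ≤ m + 1 → j ≤ n + 1 → LSKdV.F₁ α (y i j) = LSKdV.F₁ α x₀) ∧
        -- `u` solves the equation
        LSKdV.SolvesAt γ₁ γ₂ u m n ∧
        -- `v` solves the equation, where it is defined
        ((∀ i j, (i = m ∨ i = m + 1) → (j = n ∨ j = n + 1) →
            algebraMap 𝕜 ℂ (u i j) + ρ i j ≠ 0) →
          LSKdV.SolvesAt (algebraMap 𝕜 ℂ γ₁) (algebraMap 𝕜 ℂ γ₂) v m n) := by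
  have hcomm (x : LSKdV.Phase 𝕜 N) (hx₁ : x ∈ LSKdV.dom α γ₁ s₁)
      (hx₁₂ : LSKdV.S α γ₁ r₁ s₁ x ∈ LSKdV.dom α γ₂ s₂) (hx₂ : x ∈ LSKdV.dom α γ₂ s₂)
      (hx₂₁ : LSKdV.S α γ₂ r₂ s₂ x ∈ LSKdV.dom α γ₁ s₁) :=
    LSKdV.S_comm hγ₁ hγ₂ hr₁ hr₂ hs₁ hs₂ hx₁ hx₂ hx₂₁ hx₁₂
  refine ⟨hcomm, ?_⟩
  rintro x₀ y u ρ v rfl hu hρ hv m n hE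
  have hF (i j : ℕ) (hi : i ≤ m + 1) (hj : j ≤ n + 1) :=
    LSKdV.orbit_invariant (F := LSKdV.F₁ α) (fun _ hx => LSKdV.F₁_S hγ₁ hr₁ hs₁ hx)
      (fun _ hx => LSKdV.F₁_S hγ₂ hr₂ hs₂ hx) hE hi hj
  have hU : LSKdV.SolvesAt γ₁ γ₂ u m n := by
    have e₁ := LSKdV.orbit_succ_left (T₁ := LSKdV.S α γ₁ r₁ s₁) (T₂ := LSKdV.S α γ₂ r₂ s₂)
      (x₀ := x₀) m n
    have e₂ := LSKdV.orbit_succ_right hcomm hE (Nat.le_succ m) (Nat.lt_succ_self n)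
    have e₂₁ := LSKdV.orbit_succ_left (T₁ := LSKdV.S α γ₁ r₁ s₁) (T₂ := LSKdV.S α γ₂ r₂ s₂)
      (x₀ := x₀) m (n + 1)
    have d₁ := hE.1 m n (by omega) (by omega)
    have d₂ := hE.2 m n (by omega) (by omega)
    have d₁₂ := hE.2 (m + 1) n le_rfl (by omega)
    have d₂₁ := hE.1 m (n + 1) (by omega) le_rfl
    rw [e₁] at d₁₂
    rw [e₂] at d₂₁ e₂₁
    have key := LSKdV.fU_square hγ₁ hγ₂ hr₁ hr₂ hs₁ hs₂ d₁ d₂ d₂₁ d₁₂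
    -- `fU_square` reaches the far corner along both paths; commutation identifies the two.
    rw [← hcomm _ d₁ d₁₂ d₂ d₂₁, ← e₂₁, ← e₂, ← e₁] at key
    simpa only [LSKdV.SolvesAt, hu] using key
  refine ⟨hF, hU, fun hne => ?_⟩
  have hρ' (i j : ℕ) (hi : i ≤ m + 1) (hj : j ≤ n + 1) :
      ρ i j = s (-algebraMap 𝕜 ℂ (LSKdV.F₁ α x₀)) := by rw [hρ, hF i j hi hj]
  have n₀ := hne m n (.inl rfl) (.inl rfl)
  have n₁ := hne (m + 1) n (.inr rfl) (.inl rfl)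
  have n₂ := hne m (n + 1) (.inl rfl) (.inr rfl)
  have n₁₂ := hne (m + 1) (n + 1) (.inr rfl) (.inr rfl)
  have hU' := congrArg (algebraMap 𝕜 ℂ) hU
  simp only [map_sub, map_mul, map_pow, map_zero] at hU'
  simp only [LSKdV.SolvesAt, hv]
  rw [hρ' m n (by omega) (by omega)] at n₀ ⊢
  rw [hρ' (m + 1) n le_rfl (by omega)] at n₁ ⊢
  rw [hρ' m (n + 1) (by omega) le_rfl] at n₂ ⊢
  rw [hρ' (m + 1) (n + 1) le_rfl le_rfl] at n₁₂ ⊢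
  exact LSKdV.skdv_moebius n₀ n₁ n₂ n₁₂ hU'
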